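/- **Setting.** Let $V=\mathbb R^{3}$ with $Q(x)=x_0^2-x_1^2-x_2^2$; the linear model of $\mathbb H^2$ is $\{Q=1,\ x_0>0\}$, and $I(\mathbb H^2)$ is identified with the group of linear maps $T$ of $V$ preserving $Q$ and this component. The characteristic polynomial of such a $T$ is written $\chi_T(x)=(x-1)^l(x+1)^m\,\chi_{oT}(x)$, where $\chi_{oT}$ is a product of factors $x^2-2a_jx+1$ with $|a_j|<1$ and, in the hyperbolic case, of the further factor $(x-r)(x-r^{-1})$. Let $k$ be the number of the factors $x^2-2a_jx+1$, counted with multiplicity, plus $\lfloor m/2\rfloor$. $T$ is called $k$-rotatory *elliptic* if it has an eigenvector $v$ with $Q(v)>0$, $k$-rotatory *hyperbolic* if it has real eigenvalues $r,r^{-1}$ with $r\ne\pm1$, and $k$-rotatory *parabolic* if it is not semisimple, in each case when $m$ is even; when $m$ is odd the word *inversion* is added. In the upper half-plane model, respectively the unit disk model, in $\hat{\mathbb C}=\mathbb C\cup\{\infty\}$, let $G=GL(2,\mathbb R)$, respectively $G=\mathbb R_+\times SU(1,1)=\left\{t\begin{pmatrix}a&\bar c\\ c&\bar a\end{pmatrix}: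 t>0,\ |a|^2-|c|^2=1\right\}$. A matrix $A=\begin{pmatrix}a&b\\c&d\end{pmatrix}\in G$ induces the orientation-preserving isometry $z\mapsto\frac{az+b}{cz+d}$, respectively the orientation-reversing isometry $z\mapsto\frac{a\bar z+b}{c\bar z+d}$, of $\mathbb H^2$ whenever this map of $\hat{\mathbb C}$ maps the model to itself (for $A\in GL(2,\mathbb R)$: when $\det A>0$, respectively $\det A<0$; for $A\in\mathbb R_+\times SU(1,1)$: always). A *stretch* is a $0$-rotatory hyperbolic isometry which in some Möbius coordinate $w$ of $\hat{\mathbb C}$ (a $PGL(2,\mathbb C)$-translate of $z$) is $w\mapsto sw$ with $s>0$, $s\neq1$; a *translation* is a $0$-rotatory parabolic isometry which in some Möbius coordinate is $w\mapsto w+\beta$ with $\beta\ne0$; a *half-turn* is a $1$-rotatory elliptic isometry which in some Möbius coordinate is $w\mapsto -w$. **Corollary A.2.** Let $f$ be an isometry of $\mathbb H^2$ induced by $A$ in $GL(2,\mathbb R)$, respectively in $\mathbb R_+\times SU(1,1)$, and let $c(A)=\frac{(\operatorname{trace}A)^2}{\det A}$. Then $c(A)$ is a real number. I. Suppose $f$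 is orientation-preserving. 1. If $|c(A)-2|<2$, then $f$ is a $1$-rotatory elliptic. 2. If $|c(A)-2|>2$, then $f$ is a stretch. 3. If $c(A)=0$, then $f$ is a half-turn. 4. If $|c(A)-2|=2$, $c(A)\neq0$ and $A\ne rI$ for all real $r$, then $f$ is a translation. 5. If $|c(A)-2|=2$ and $A=rI$ for some real $r$, then $f$ is the identity. II. Suppose $f$ is orientation-reversing, and let $B=A\bar A$, where $\bar A$ is the entrywise complex conjugate of $A$. 1. If $|c(B)-2|>2$, then $f$ is a $0$-rotatory hyperbolic inversion. 2. If $B\neq rI$ for all real $r$ and $|c(B)-2|<2$, then $f$ is a $1$-rotatory elliptic inversion. 3. If $B=rI$ for some real $r$, then $f$ is a $0$-rotatory elliptic inversion; in this case $f$ is an inversion in a circle of $\hat{\mathbb C}$ (a Euclidean circle, or a line completed by $\infty$). -/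

import Mathlib

open Polynomial OnePoint Matrix

/-! ## The linear model of hyperbolic `n`-space and the dynamical types -/

namespace Hyperbolic

/-- The underlying vector space `ℝ^(n+1)` of the linear model. -/
abbrev LorentzSpace (n : ℕ) : Type := Fin (n + 1) → ℝ

/-- The quadratic form `x₀² - x₁² - ⋯ - xₙ²`, of signature `(1, n)`. -/
def lorentzForm {n : ℕ} (v : LorentzSpace n) : ℝ :=
  v 0 ^ 2 - ∑ i : Fin n, v i.succ ^ 2

/-- Hyperbolic `n`-space: the component `x₀ > 0` of the hyperboloid where the form is `1`. -/
def hyperboloid (n : ℕ) : Set (LorentzSpace n) :=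
  {v | lorentzForm v = 1 ∧ 0 < v 0}

/-- `T` belongs to the isometry group of hyperbolic `n`-space, that is, `T` is a linear map that
preserves the form and the chosen component of the hyperboloid. -/
def IsLorentzIsometry {n : ℕ} (T : Module.End ℝ (LorentzSpace n)) : Prop :=
  (∀ v, lorentzForm (T v) = lorentzForm v) ∧ Set.MapsTo T (hyperboloid n) (hyperboloid n)

/-- The characteristic polynomial of `T` has the form
`(X - 1)^l (X + 1)^m p(X) ∏ⱼ (X² - 2 aⱼ X + 1)` with all `|aⱼ| < 1` (the `aⱼ` being listed with
multiplicity), and `k` is the number of the `aⱼ` plus the integral part of `m / 2`. -/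
def HasCharpolyForm {n : ℕ} (T : Module.End ℝ (LorentzSpace n)) (p : ℝ[X]) (k m : ℕ) : Prop :=
  ∃ (l : ℕ) (S : Multiset ℝ), (∀ a ∈ S, |a| < 1) ∧
    T.charpoly = (X - 1) ^ l * (X + 1) ^ m *
      (p * (S.map fun a => X ^ 2 - C (2 * a) * X + 1).prod) ∧
    k = Multiset.card S + m / 2

/-- Elliptic type: there is a time-like eigenvector. The number of rotations is `k`, and `m` is
the multiplicity of the eigenvalue `-1`. -/
def EllipticType {n : ℕ} (T : Module.End ℝ (LorentzSpace n)) (k m : ℕ) : Prop :=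
  (∃ (v : LorentzSpace n) (s : ℝ), 0 < lorentzForm v ∧ T v = s • v) ∧ HasCharpolyForm T 1 k m

/-- Hyperbolic type: there is a pair of real eigenvalues `r, r⁻¹` with `r ≠ ±1`. -/
def HyperbolicType {n : ℕ} (T : Module.End ℝ (LorentzSpace n)) (k m : ℕ) : Prop :=
  ∃ r : ℝ, r ≠ 0 ∧ r ≠ 1 ∧ r ≠ -1 ∧ HasCharpolyForm T ((X - C r) * (X - C r⁻¹)) k m

/-- Parabolic type: `T` is not semisimple. -/
def ParabolicType {n : ℕ} (T : Module.End ℝ (LorentzSpace n)) (k m : ℕ) : Prop :=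
  ¬ T.IsSemisimple ∧ HasCharpolyForm T 1 k m

/-! ## The two conformal models of the hyperbolic plane inside the extended complex plane -/

/-- The two conformal models of the hyperbolic plane. -/
inductive PlaneModel : Type
  | upperHalfPlane
  | disk

namespace PlaneModel

/-- The points of the model. -/
def points : PlaneModel → Set ℂ
  | upperHalfPlane => {z | 0 < z.im}
  | disk => {z | ‖z‖ < 1}

/-- The standard isometry of the model with the linear model; only its values on the points of
the model matter. -/
noncomputable def toLorentz : PlaneModel → ℂ → LorentzSpace 2
  | upperHalfPlane, z =>
      ![(‖z‖ ^ 2 + 1) / (2 * z.im), (‖z‖ ^ 2 - 1) / (2 * z.im), z.re / z.im]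
  | disk, z =>
      ![(1 + ‖z‖ ^ 2) / (1 - ‖z‖ ^ 2), 2 * z.re / (1 - ‖z‖ ^ 2), 2 * z.im / (1 - ‖z‖ ^ 2)]

/-- The group of matrices in `GL(2, ℂ)` which is used with the model: `GL(2, ℝ)` for the upper half
plane, and `ℝ₊ × SU(1,1)` (products of a positive real and an element of `SU(1,1)`) for the
disk. -/
def lifts : PlaneModel → Set (GL (Fin 2) ℂ)
  | upperHalfPlane => {A | ∃ g : GL (Fin 2) ℝ, A = g.map Complex.ofRealHom}
  | disk => {A | ∃ (t : ℝ) (a c : ℂ), 0 < t ∧ ‖a‖ ^ 2 - ‖c‖ ^ 2 = 1 ∧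
      (A : Matrix (Fin 2) (Fin 2) ℂ) =
        (t : ℂ) • !![a, starRingEnd ℂ c; c, starRingEnd ℂ a]}

/-- `f` maps the model to itself. -/
def Preserves (M : PlaneModel) (f : OnePoint ℂ → OnePoint ℂ) : Prop :=
  ∀ z ∈ M.points, ∃ w ∈ M.points, f z = w

/-- `f` is an orientation-preserving isometry of the hyperbolic plane, in the model `M`, which is
induced by `A`: it is `z ↦ (a z + b) / (c z + d)` on the extended plane and maps the model to
itself (in the upper half plane, with `A` real, this means `det A > 0`). -/
def InducesPreserving (M : PlaneModel) (A : GL (Fin 2) ℂ) (f : OnePoint ℂ → OnePoint ℂ) : Prop :=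
  (∀ w, f w = A • w) ∧ M.Preserves f

/-- `f` is an orientation-reversing isometry of the hyperbolic plane, in the model `M`, which is
induced by `A`: it is `z ↦ (a z̄ + b) / (c z̄ + d)` on the extended plane and maps the model to
itself (in the upper half plane, with `A` real, this means `det A < 0`). -/
def InducesReversing (M : PlaneModel) (A : GL (Fin 2) ℂ) (f : OnePoint ℂ → OnePoint ℂ) : Prop :=
  (∀ w, f w = A • OnePoint.map (starRingEnd ℂ) w) ∧ M.Preserves f

/-- `T` is the isometry of the linear model that corresponds to the action of `f` on `M`. -/
def ActsAs (M : PlaneModel) (f : OnePoint ℂ → OnePoint ℂ)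
    (T : Module.End ℝ (LorentzSpace 2)) : Prop :=
  IsLorentzIsometry T ∧
    ∀ z ∈ M.points, ∃ w ∈ M.points, f z = w ∧ M.toLorentz w = T (M.toLorentz z)

/-- `f` acts on the model as a `k`-rotatory elliptic. -/
def IsElliptic (M : PlaneModel) (k : ℕ) (f : OnePoint ℂ → OnePoint ℂ) : Prop :=
  ∃ T, M.ActsAs f T ∧ ∃ m, Even m ∧ EllipticType T k m

/-- `f` acts on the model as a `k`-rotatory elliptic inversion. -/
def IsEllipticInversion (M : PlaneModel) (k : ℕ) (f : OnePoint ℂ → OnePoint ℂ) : Prop :=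
  ∃ T, M.ActsAs f T ∧ ∃ m, Odd m ∧ EllipticType T k m

/-- `f` acts on the model as a `k`-rotatory hyperbolic. -/
def IsHyperbolic (M : PlaneModel) (k : ℕ) (f : OnePoint ℂ → OnePoint ℂ) : Prop :=
  ∃ T, M.ActsAs f T ∧ ∃ m, Even m ∧ HyperbolicType T k m

/-- `f` acts on the model as a `k`-rotatory hyperbolic inversion. -/
def IsHyperbolicInversion (M : PlaneModel) (k : ℕ) (f : OnePoint ℂ → OnePoint ℂ) : Prop :=
  ∃ T, M.ActsAs f T ∧ ∃ m, Odd m ∧ HyperbolicType T k m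

/-- `f` acts on the model as a `k`-rotatory parabolic. -/
def IsParabolic (M : PlaneModel) (k : ℕ) (f : OnePoint ℂ → OnePoint ℂ) : Prop :=
  ∃ T, M.ActsAs f T ∧ ∃ m, Even m ∧ ParabolicType T k m

/-- A stretch: a `0`-rotatory hyperbolic which is `w ↦ s w` with `s > 0`, `s ≠ 1`, in a suitable
Möbius coordinate `w` of the extended plane. -/
def IsStretch (M : PlaneModel) (f : OnePoint ℂ → OnePoint ℂ) : Prop :=
  M.IsHyperbolic 0 f ∧ ∃ (P : GL (Fin 2) ℂ) (s : ℝ), 0 < s ∧ s ≠ 1 ∧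
    ∀ w : OnePoint ℂ, P • f (P⁻¹ • w) = OnePoint.map (fun z => (s : ℂ) * z) w

/-- A translation: a `0`-rotatory parabolic which is `w ↦ w + β` with `β ≠ 0` in a suitable
Möbius coordinate `w` of the extended plane. -/
def IsTranslation (M : PlaneModel) (f : OnePoint ℂ → OnePoint ℂ) : Prop :=
  M.IsParabolic 0 f ∧ ∃ (P : GL (Fin 2) ℂ) (β : ℂ), β ≠ 0 ∧
    ∀ w : OnePoint ℂ, P • f (P⁻¹ • w) = OnePoint.map (fun z => z + β) w

/-- A half-turn: a `1`-rotatory elliptic with rotation angle `π`, i.e. `w ↦ -w` in a suitable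
Möbius coordinate `w` of the extended plane. -/
def IsHalfTurn (M : PlaneModel) (f : OnePoint ℂ → OnePoint ℂ) : Prop :=
  M.IsElliptic 1 f ∧ ∃ P : GL (Fin 2) ℂ,
    ∀ w : OnePoint ℂ, P • f (P⁻¹ • w) = OnePoint.map (fun z => -z) w

end PlaneModel

/-- `f` is the inversion in a circle of the extended complex plane: either in a Euclidean circle
with centre `p` and radius `R`, or in a line through `p` with direction `u`, completed by `∞`. -/
def IsCircleInversion (f : OnePoint ℂ → OnePoint ℂ) : Prop :=
  (∃ (p : ℂ) (R : ℝ), 0 < R ∧ f ∞ = (p : OnePoint ℂ) ∧ f p = ∞ ∧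
    ∀ z : ℂ, z ≠ p → f z = (EuclideanGeometry.inversion p R z : ℂ)) ∨
  (∃ p u : ℂ, ‖u‖ = 1 ∧ f ∞ = ∞ ∧
    ∀ z : ℂ, f z = (p + u ^ 2 * starRingEnd ℂ (z - p) : ℂ))

/-- The invariant `c(A) = (trace A)² / det A`; the determinant is nonzero. -/
noncomputable def cInv (A : GL (Fin 2) ℂ) : ℂ :=
  Matrix.trace (A : Matrix (Fin 2) (Fin 2) ℂ) ^ 2 / Matrix.det (A : Matrix (Fin 2) (Fin 2) ℂ)

/-- The entrywise complex conjugate of a matrix. -/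
noncomputable def conjMatrix (A : GL (Fin 2) ℂ) : GL (Fin 2) ℂ :=
  Matrix.GeneralLinearGroup.map (starRingEnd ℂ) A

/-- `A = r I` for some real `r`. -/
def IsRealScalar (A : GL (Fin 2) ℂ) : Prop :=
  ∃ r : ℝ, (A : Matrix (Fin 2) (Fin 2) ℂ) = (r : ℂ) • 1

end Hyperbolic

namespace Hyperbolic

/-! ## Linear maps of the three-dimensional Lorentz space -/

/-! After scaling by a positive real, `A` has determinant `ε = ±1` and acts on the three-dimensional
Lorentz space by an explicit `3 × 3` matrix. In the half-plane model this is the action `S ↦ A S Aᵀ`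
on symmetric matrices with the determinant as form; the disk has an analogous matrix. The
characteristic polynomial of this action is always `(X - ε)(X² - σX + 1)`, with `ε = 1` or `-1`
according to orientation (in the disk the sign comes from conjugation), so the single real number
`σ` decides the type.

In the preserving case `c(A) = σ + 2` with `σ ≥ -2`, hence `|c(A) - 2| = |σ|`. For `σ < 2` the
traceless part of `A` gives a fixed time-like vector; for `σ > 2` the quadratic has real roots `r,
r⁻¹`; for `σ = 2` the map is unipotent, so it is semisimple only if it is the identity, i.e. `A` is
scalar. The Möbius normal forms come from diagonalising `A` over `ℂ`, or from its Jordan block.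

In the reversing case `A Ā` has trace `δσ` and determinant `δ²`, with `σ ≥ 2`. Thus `c(B) - 2 = σ² -
2 ≥ 2`: the case `|c(B) - 2| < 2` never occurs, and a scalar `B` forces `σ = 2`.

The two models are treated uniformly through `exists_lorentz_of_preserving` and
`exists_lorentz_of_reversing`. -/

theorem lorentzForm_two (v : LorentzSpace 2) :
    lorentzForm v = v 0 ^ 2 - v 1 ^ 2 - v 2 ^ 2 := by
  simp [lorentzForm, Fin.sum_univ_two]
  ring

/-- A `3 × 3` matrix as an endomorphism of `LorentzSpace 2`. -/
noncomputable def lorentzMap (N : Matrix (Fin 3) (Fin 3) ℝ) : Module.End ℝ (LorentzSpace 2) :=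
  Matrix.toLin' N

theorem lorentzMap_apply (N : Matrix (Fin 3) (Fin 3) ℝ) (v : LorentzSpace 2) :
    lorentzMap N v = ![N 0 0 * v 0 + N 0 1 * v 1 + N 0 2 * v 2,
      N 1 0 * v 0 + N 1 1 * v 1 + N 1 2 * v 2, N 2 0 * v 0 + N 2 1 * v 1 + N 2 2 * v 2] := by
  ext i
  fin_cases i <;> simp [lorentzMap, Matrix.mulVec, dotProduct, Fin.sum_univ_three]

/-- The three hypotheses match the coefficients of the expanded cubic: trace, sum of principal
minors, determinant. -/
theorem charpoly_lorentzMap {N : Matrix (Fin 3) (Fin 3) ℝ} {ε σ : ℝ}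
    (htr : N 0 0 + N 1 1 + N 2 2 = ε + σ)
    (hminor : N 0 0 * N 1 1 - N 0 1 * N 1 0 + (N 0 0 * N 2 2 - N 0 2 * N 2 0)
      + (N 1 1 * N 2 2 - N 1 2 * N 2 1) = 1 + ε * σ)
    (hdet : N.det = ε) :
    (lorentzMap N).charpoly = (X - C ε) * (X ^ 2 - C σ * X + 1) := by
  have h : (lorentzMap N).charpoly = N.charpoly := Matrix.charpoly_toLin' N
  rw [h, Matrix.charpoly, Matrix.det_fin_three]
  rw [Matrix.det_fin_three] at hdet
  have h1 := congrArg (C : ℝ →+* ℝ[X]) htr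
  have h2 := congrArg (C : ℝ →+* ℝ[X]) hminor
  have h3 := congrArg (C : ℝ →+* ℝ[X]) hdet
  simp only [map_add, map_mul, map_sub, map_one] at h1 h2 h3
  simp only [Matrix.charmatrix_apply, Matrix.diagonal_apply, Fin.isValue, if_true,
    Fin.reduceEq, if_false, zero_sub]
  linear_combination (-X ^ 2) * h1 + X * h2 - h3

theorem isLorentzIsometry_of_lorentzForm {T : Module.End ℝ (LorentzSpace 2)} {a b c : ℝ}
    (hform : ∀ v, lorentzForm (T v) = lorentzForm v)
    (hrow : ∀ v, T v 0 = a * v 0 + b * v 1 + c * v 2)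
    (habc : a ^ 2 - b ^ 2 - c ^ 2 = 1) (ha : 0 < a) : IsLorentzIsometry T := by
  refine ⟨hform, fun v hv => ⟨(hform v).trans hv.1, ?_⟩⟩
  obtain ⟨h1, h0⟩ := hv
  rw [lorentzForm_two] at h1
  -- Cauchy–Schwarz bounds the space part by `(a² - 1)(v₀² - 1)`, so the term `a v₀` determines the
  -- sign of the new time coordinate.
  have hlt : (b * v 1 + c * v 2) ^ 2 < (a * v 0) ^ 2 := by
    have : (b * v 1 + c * v 2) ^ 2 ≤ (a ^ 2 - 1) * (v 0 ^ 2 - 1) := by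
      rw [show a ^ 2 - 1 = b ^ 2 + c ^ 2 by linarith,
        show v 0 ^ 2 - 1 = v 1 ^ 2 + v 2 ^ 2 by linarith]
      nlinarith [sq_nonneg (b * v 2 - c * v 1)]
    nlinarith [sq_nonneg (v 1), sq_nonneg (v 2), sq_nonneg b, sq_nonneg c]
  have := (abs_lt.1 (abs_lt_of_sq_lt_sq hlt (by positivity))).1
  rw [hrow]
  linarith

/-! ## The dynamical type read off from the characteristic polynomial -/

variable {T : Module.End ℝ (LorentzSpace 2)} {σ : ℝ}

theorem ellipticType_one_of_charpoly (hT : T.charpoly = (X - C 1) * (X ^ 2 - C σ * X + 1))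
    (h1 : -2 ≤ σ) (h2 : σ < 2)
    (hv : ∃ v : LorentzSpace 2, 0 < lorentzForm v ∧ T v = v) :
    ∃ m, Even m ∧ EllipticType T 1 m := by
  obtain ⟨v, hv, hTv⟩ := hv
  have hv' : ∃ (v : LorentzSpace 2) (s : ℝ), 0 < lorentzForm v ∧ T v = s • v :=
    ⟨v, 1, hv, by rw [hTv, one_smul]⟩
  rcases h1.eq_or_lt with rfl | h1
  -- At `σ = -2` the quadratic is `(X + 1)²`, which the bound `|a| < 1` excludes from the rotation
  -- factors; the rotation is counted by `m / 2 = 1` instead.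
  · refine ⟨2, even_two, hv', 1, 0, by simp, ?_, by simp⟩
    rw [hT]
    simp only [map_neg, map_ofNat, map_one, Multiset.map_zero, Multiset.prod_zero]
    ring
  · refine ⟨0, Even.zero, hv', 1, {σ / 2}, ?_, ?_, by simp⟩
    · simp only [Multiset.mem_singleton, forall_eq]
      rw [abs_lt]
      constructor <;> linarith
    · rw [hT, Multiset.map_singleton, Multiset.prod_singleton, mul_div_cancel₀ σ two_ne_zero]
      simp

/-- A real number larger than `2` is `r + r⁻¹` for some `r > 1`. -/
theorem exists_add_inv_eq {σ : ℝ} (h : 2 < σ) : ∃ r : ℝ, 1 < r ∧ r + r⁻¹ = σ := by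
  have hs : 0 ≤ σ ^ 2 - 4 := by nlinarith
  have hsq := Real.sq_sqrt hs
  have h0 := Real.sqrt_nonneg (σ ^ 2 - 4)
  refine ⟨(σ + √(σ ^ 2 - 4)) / 2, by linarith, ?_⟩
  have : (σ + √(σ ^ 2 - 4)) ≠ 0 := by linarith
  field_simp
  linarith

theorem quadratic_eq_of_add_inv {r : ℝ} (hr : r ≠ 0) (h : r + r⁻¹ = σ) :
    (X ^ 2 - C σ * X + 1 : ℝ[X]) = (X - C r) * (X - C r⁻¹) := by
  have h1 : (C r * C r⁻¹ : ℝ[X]) = 1 := by rw [← C_mul, mul_inv_cancel₀ hr, C_1]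
  rw [← h, C_add]
  linear_combination -h1

theorem hyperbolicType_zero_of_charpoly (hT : T.charpoly = (X - C 1) * (X ^ 2 - C σ * X + 1))
    (h : 2 < σ) : ∃ m, Even m ∧ HyperbolicType T 0 m := by
  obtain ⟨r, hr, hrσ⟩ := exists_add_inv_eq h
  refine ⟨0, Even.zero, r, by linarith, by linarith, by linarith, 1, 0, by simp, ?_, by simp⟩
  rw [hT, quadratic_eq_of_add_inv (by linarith) hrσ]
  simp

theorem hyperbolicType_zero_odd_of_charpoly
    (hT : T.charpoly = (X - C (-1)) * (X ^ 2 - C σ * X + 1))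
    (h : 2 < σ) : ∃ m, Odd m ∧ HyperbolicType T 0 m := by
  obtain ⟨r, hr, hrσ⟩ := exists_add_inv_eq h
  refine ⟨1, odd_one, r, by linarith, by linarith, by linarith, 0, 0, by simp, ?_, by simp⟩
  rw [hT, quadratic_eq_of_add_inv (by linarith) hrσ]
  simp

theorem ellipticType_zero_odd_of_charpoly
    (hT : T.charpoly = (X - C (-1)) * (X ^ 2 - C 2 * X + 1))
    (hv : ∃ v : LorentzSpace 2, 0 < lorentzForm v ∧ T v = v) :
    ∃ m, Odd m ∧ EllipticType T 0 m := by
  obtain ⟨v, hv, hTv⟩ := hv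
  refine ⟨1, odd_one, ⟨v, 1, hv, by rw [hTv, one_smul]⟩, 2, 0, by simp, ?_, by simp⟩
  rw [hT]
  simp only [map_neg, map_ofNat, map_one, Multiset.map_zero, Multiset.prod_zero]
  ring

/-- By Cayley–Hamilton `T - 1` is nilpotent; if `T` were semisimple, `T - 1` would be too, hence
zero. -/
theorem parabolicType_zero_of_charpoly (hT : T.charpoly = (X - C 1) * (X ^ 2 - C 2 * X + 1))
    (h : T ≠ 1) : ∃ m, Even m ∧ ParabolicType T 0 m := by
  have hT' : T.charpoly = (X - 1) ^ 3 := by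
    rw [hT]
    simp only [map_ofNat, map_one]
    ring
  refine ⟨0, Even.zero, fun hss => h ?_, 3, 0, by simp, ?_, by simp⟩
  · have hnil : IsNilpotent (T - 1) := by
      refine ⟨3, ?_⟩
      have := T.aeval_self_charpoly
      rw [hT'] at this
      simpa using this
    have hss' : (T - 1).IsSemisimple := by
      have := (Module.End.isSemisimple_sub_algebraMap_iff (f := T) (μ := (1 : ℝ))).2 hss
      simpa using this
    exact sub_eq_zero.1 (Module.End.eq_zero_of_isNilpotent_isSemisimple hnil hss')
  · rw [hT']
    simp

/-! ## Möbius transformations of the extended complex plane -/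

theorem smul_scalar {A : GL (Fin 2) ℂ} {μ : ℂ}
    (hA : (A : Matrix (Fin 2) (Fin 2) ℂ) = μ • 1) (w : OnePoint ℂ) : A • w = w := by
  have h00 : A 0 0 = μ := by rw [hA]; simp
  have h01 : A 0 1 = 0 := by rw [hA]; simp
  have h10 : A 1 0 = 0 := by rw [hA]; simp
  have h11 : A 1 1 = μ := by rw [hA]; simp
  have hμ : μ ≠ 0 := by
    rintro rfl
    exact A.det_ne_zero (by rw [hA]; simp)
  cases w with
  | infty => simp [smul_infty_eq_ite, h10]
  | coe z => simp [smul_some_eq_ite, h00, h01, h10, h11, hμ]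

/-- If `P A = D P` then `A` acts as `D` in the coordinate given by `P`. -/
theorem smul_smul_inv_smul {A P D : GL (Fin 2) ℂ}
    (h : (P : Matrix (Fin 2) (Fin 2) ℂ) * (A : Matrix (Fin 2) (Fin 2) ℂ) =
      (D : Matrix (Fin 2) (Fin 2) ℂ) * (P : Matrix (Fin 2) (Fin 2) ℂ)) (w : OnePoint ℂ) :
    P • A • P⁻¹ • w = D • w := by
  have h' : P * A = D * P := Units.ext h
  rw [smul_smul, smul_smul, h', mul_inv_cancel_right]

/-- A matrix with invariant `s + 2 + s⁻¹` acts as `w ↦ s w` in a suitable coordinate. -/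
theorem exists_conj_eq_mul {A : GL (Fin 2) ℂ} {s : ℂ} (hs0 : s ≠ 0) (hs1 : s ≠ 1)
    (hc : s * trace (A : Matrix (Fin 2) (Fin 2) ℂ) ^ 2 =
      (1 + s) ^ 2 * det (A : Matrix (Fin 2) (Fin 2) ℂ)) :
    ∃ P : GL (Fin 2) ℂ, ∀ w : OnePoint ℂ,
      P • A • P⁻¹ • w = OnePoint.map (fun z => s * z) w := by
  have hdet := A.det_ne_zero
  -- The eigenvalues are to be `sμ` and `μ`. The determinant fixes `μ` up to sign, and the trace
  -- selects the sign.
  obtain ⟨μ, htr, hd⟩ : ∃ μ : ℂ, trace (A : Matrix (Fin 2) (Fin 2) ℂ) = (1 + s) * μ ∧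
      det (A : Matrix (Fin 2) (Fin 2) ℂ) = s * μ ^ 2 := by
    obtain ⟨μ, hμ⟩ :=
      IsAlgClosed.exists_pow_nat_eq (det (A : Matrix (Fin 2) (Fin 2) ℂ) / s) two_pos
    have hd : det (A : Matrix (Fin 2) (Fin 2) ℂ) = s * μ ^ 2 := by
      rw [hμ, mul_div_cancel₀ _ hs0]
    have hsq : trace (A : Matrix (Fin 2) (Fin 2) ℂ) ^ 2 = ((1 + s) * μ) ^ 2 := by
      apply mul_left_cancel₀ hs0
      rw [hc, hd]
      ring
    rcases sq_eq_sq_iff_eq_or_eq_neg.1 hsq with h | h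
    · exact ⟨μ, h, hd⟩
    · exact ⟨-μ, by rw [h]; ring, by rw [hd]; ring⟩
  have hμ : μ ≠ 0 := by
    rintro rfl
    exact hdet (by rw [hd]; ring)
  have hs1' : s - 1 ≠ 0 := sub_ne_zero.2 hs1
  rw [trace_fin_two] at htr
  rw [det_fin_two] at hd
  -- The rows of `P` are left eigenvectors of `A` for `sμ` and `μ`; their explicit form depends on
  -- which off-diagonal entry is nonzero.
  have key : ∃ P : Matrix (Fin 2) (Fin 2) ℂ, P.det ≠ 0 ∧
      P * (A : Matrix (Fin 2) (Fin 2) ℂ) = !![s * μ, 0; 0, μ] * P := by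
    by_cases hb : (A : Matrix (Fin 2) (Fin 2) ℂ) 0 1 = 0
    · by_cases hcc : (A : Matrix (Fin 2) (Fin 2) ℂ) 1 0 = 0
      · rw [hb, hcc] at hd
        have hroot : ((A : Matrix (Fin 2) (Fin 2) ℂ) 0 0 - s * μ) *
            ((A : Matrix (Fin 2) (Fin 2) ℂ) 0 0 - μ) = 0 := by
          linear_combination (A : Matrix (Fin 2) (Fin 2) ℂ) 0 0 * htr - hd
        rcases mul_eq_zero.1 hroot with h | h
        · refine ⟨1, by simp, ?_⟩
          rw [Matrix.eta_fin_two (A : Matrix (Fin 2) (Fin 2) ℂ), hb, hcc, one_mul, mul_one,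
            show (A : Matrix (Fin 2) (Fin 2) ℂ) 0 0 = s * μ by linear_combination h,
            show (A : Matrix (Fin 2) (Fin 2) ℂ) 1 1 = μ by linear_combination htr - h]
        · refine ⟨!![0, 1; 1, 0], by simp [det_fin_two], ?_⟩
          rw [Matrix.eta_fin_two (A : Matrix (Fin 2) (Fin 2) ℂ), hb, hcc,
            show (A : Matrix (Fin 2) (Fin 2) ℂ) 0 0 = μ by linear_combination h,
            show (A : Matrix (Fin 2) (Fin 2) ℂ) 1 1 = s * μ by linear_combination htr - h]
          simp
      · refine ⟨!![(A : Matrix (Fin 2) (Fin 2) ℂ) 1 0, (A : Matrix (Fin 2) (Fin 2) ℂ) 1 1 - μ;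
          (A : Matrix (Fin 2) (Fin 2) ℂ) 1 0, (A : Matrix (Fin 2) (Fin 2) ℂ) 1 1 - s * μ], ?_, ?_⟩
        · rw [det_fin_two_of]
          rw [show ∀ c d : ℂ, c * (d - s * μ) - (d - μ) * c = -(c * (s - 1) * μ) by intros; ring]
          exact neg_ne_zero.2 (mul_ne_zero (mul_ne_zero hcc hs1') hμ)
        · nth_rw 3 [Matrix.eta_fin_two (A : Matrix (Fin 2) (Fin 2) ℂ)]
          ext i j
          fin_cases i <;> fin_cases j <;> simp [Matrix.mul_apply, Fin.sum_univ_two] <;> grind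
    · refine ⟨!![(A : Matrix (Fin 2) (Fin 2) ℂ) 0 0 - μ, (A : Matrix (Fin 2) (Fin 2) ℂ) 0 1;
        (A : Matrix (Fin 2) (Fin 2) ℂ) 0 0 - s * μ, (A : Matrix (Fin 2) (Fin 2) ℂ) 0 1], ?_, ?_⟩
      · rw [det_fin_two_of]
        rw [show ∀ a b : ℂ, (a - μ) * b - b * (a - s * μ) = b * (s - 1) * μ by intros; ring]
        exact mul_ne_zero (mul_ne_zero hb hs1') hμ
      · ext i j
        fin_cases i <;> fin_cases j <;> simp [Matrix.mul_apply, Fin.sum_univ_two] <;> grind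
  obtain ⟨P, hP, hPA⟩ := key
  have hD : (!![s * μ, 0; 0, μ] : Matrix (Fin 2) (Fin 2) ℂ).det ≠ 0 := by
    rw [det_fin_two_of]
    simp [hs0, hμ]
  refine ⟨GeneralLinearGroup.mkOfDetNeZero P hP, fun w => ?_⟩
  rw [smul_smul_inv_smul (D := GeneralLinearGroup.mkOfDetNeZero _ hD) hPA]
  cases w with
  | infty => simp [smul_infty_eq_ite, GeneralLinearGroup.mkOfDetNeZero]
  | coe z =>
    simp [smul_some_eq_ite, GeneralLinearGroup.mkOfDetNeZero, hμ]
    field_simp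

/-- A nonscalar matrix with `(trace A)² = 4 det A` acts as `w ↦ w + β` in a suitable coordinate. -/
theorem exists_conj_eq_add {A : GL (Fin 2) ℂ}
    (hA : ∀ μ : ℂ, (A : Matrix (Fin 2) (Fin 2) ℂ) ≠ μ • 1)
    (hc : trace (A : Matrix (Fin 2) (Fin 2) ℂ) ^ 2 =
      4 * det (A : Matrix (Fin 2) (Fin 2) ℂ)) :
    ∃ (P : GL (Fin 2) ℂ) (β : ℂ), β ≠ 0 ∧ ∀ w : OnePoint ℂ,
      P • A • P⁻¹ • w = OnePoint.map (fun z => z + β) w := by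
  have hdet := A.det_ne_zero
  obtain ⟨μ, htr⟩ : ∃ μ : ℂ, trace (A : Matrix (Fin 2) (Fin 2) ℂ) = 2 * μ :=
    ⟨trace (A : Matrix (Fin 2) (Fin 2) ℂ) / 2, by ring⟩
  have hd : det (A : Matrix (Fin 2) (Fin 2) ℂ) = μ ^ 2 := by
    rw [htr] at hc
    linear_combination -hc / 4
  have hμ : μ ≠ 0 := by
    rintro rfl
    exact hdet (by rw [hd]; ring)
  rw [trace_fin_two] at htr
  rw [det_fin_two] at hd
  -- The second row of `P` is a left eigenvector and the first a generalised one. The Jordan block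
  -- acts as `w ↦ w + μ⁻¹`.
  have key : ∃ P : Matrix (Fin 2) (Fin 2) ℂ, P.det ≠ 0 ∧
      P * (A : Matrix (Fin 2) (Fin 2) ℂ) = !![μ, 1; 0, μ] * P := by
    by_cases hb : (A : Matrix (Fin 2) (Fin 2) ℂ) 0 1 = 0
    · by_cases hcc : (A : Matrix (Fin 2) (Fin 2) ℂ) 1 0 = 0
      · rw [hb, hcc] at hd
        have h : ((A : Matrix (Fin 2) (Fin 2) ℂ) 0 0 - μ) ^ 2 = 0 := by
          linear_combination (A : Matrix (Fin 2) (Fin 2) ℂ) 0 0 * htr - hd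
        have h := pow_eq_zero_iff two_ne_zero |>.1 h
        refine absurd ?_ (hA μ)
        rw [Matrix.eta_fin_two (A : Matrix (Fin 2) (Fin 2) ℂ), hb, hcc,
            show (A : Matrix (Fin 2) (Fin 2) ℂ) 0 0 = μ by linear_combination h,
            show (A : Matrix (Fin 2) (Fin 2) ℂ) 1 1 = μ by linear_combination htr - h]
        ext i j
        fin_cases i <;> fin_cases j <;> simp
      · refine ⟨!![0, 1; (A : Matrix (Fin 2) (Fin 2) ℂ) 1 0,
          (A : Matrix (Fin 2) (Fin 2) ℂ) 1 1 - μ], by simpa [det_fin_two_of] using hcc, ?_⟩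
        ext i j
        fin_cases i <;> fin_cases j <;> simp [Matrix.mul_apply, Fin.sum_univ_two] <;> grind
    · refine ⟨!![1, 0; (A : Matrix (Fin 2) (Fin 2) ℂ) 0 0 - μ,
        (A : Matrix (Fin 2) (Fin 2) ℂ) 0 1], by simpa [det_fin_two_of] using hb, ?_⟩
      ext i j
      fin_cases i <;> fin_cases j <;> simp [Matrix.mul_apply, Fin.sum_univ_two] <;> grind
  obtain ⟨P, hP, hPA⟩ := key
  have hD : (!![μ, 1; 0, μ] : Matrix (Fin 2) (Fin 2) ℂ).det ≠ 0 := by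
    rw [det_fin_two_of]
    simp [hμ]
  refine ⟨GeneralLinearGroup.mkOfDetNeZero P hP, μ⁻¹, inv_ne_zero hμ, fun w => ?_⟩
  rw [smul_smul_inv_smul (D := GeneralLinearGroup.mkOfDetNeZero _ hD) hPA]
  cases w with
  | infty => simp [smul_infty_eq_ite, GeneralLinearGroup.mkOfDetNeZero]
  | coe z =>
    simp [smul_some_eq_ite, GeneralLinearGroup.mkOfDetNeZero, hμ]
    field_simp

open ComplexConjugate in
/-- If `A Ā` is a positive scalar, then `z ↦ A z̄` is the inversion in a circle. -/
theorem isCircleInversion_of_mul_conj {A : GL (Fin 2) ℂ} {r : ℝ} (hr : 0 < r)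
    (hA : ((A * conjMatrix A : GL (Fin 2) ℂ) : Matrix (Fin 2) (Fin 2) ℂ) = (r : ℂ) • 1)
    {f : OnePoint ℂ → OnePoint ℂ} (hf : ∀ w, f w = A • OnePoint.map (starRingEnd ℂ) w) :
    IsCircleInversion f := by
  have hdet := A.det_ne_zero
  rw [det_fin_two] at hdet
  have h00 := congrFun (congrFun hA 0) 0
  have h01 := congrFun (congrFun hA 0) 1
  have h10 := congrFun (congrFun hA 1) 0
  have h11 := congrFun (congrFun hA 1) 1
  simp [conjMatrix, Matrix.mul_apply, Fin.sum_univ_two] at h00 h01 h10 h11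
  have hinf : f ∞ = if A 1 0 = 0 then ∞ else ((A 0 0 / A 1 0 : ℂ) : OnePoint ℂ) := by
    rw [hf, OnePoint.map_infty, smul_infty_eq_ite]
  have hcoe : ∀ z : ℂ, f z = if A 1 0 * conj z + A 1 1 = 0 then ∞ else
      (((A 0 0 * conj z + A 0 1) / (A 1 0 * conj z + A 1 1) : ℂ) : OnePoint ℂ) := by
    intro z
    rw [hf, OnePoint.map_some, smul_some_eq_ite]
  generalize (A 0 0 : ℂ) = α at *
  generalize (A 0 1 : ℂ) = β at *
  generalize (A 1 0 : ℂ) = γ at *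
  generalize (A 1 1 : ℂ) = δ at *
  by_cases hγ : γ = 0
  · subst hγ
    right
    have hα : α ≠ 0 := by rintro rfl; simp at hdet
    have hδ : δ ≠ 0 := by rintro rfl; simp at hdet
    have hδ' : conj δ ≠ 0 := by simpa using hδ
    simp at h00 h01 h11
    have hnorm : ‖α / δ‖ = 1 := by
      have e1 : ‖α‖ ^ 2 = r := by
        rw [Complex.mul_conj'] at h00; exact_mod_cast h00
      have e2 : ‖δ‖ ^ 2 = r := by
        rw [Complex.mul_conj'] at h11; exact_mod_cast h11
      rw [norm_div, div_eq_one_iff_eq (by simpa using hδ)]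
      exact (pow_left_inj₀ (norm_nonneg _) (norm_nonneg _) two_ne_zero).1 (e1.trans e2.symm)
    -- Here the map is `z ↦ (α/δ) z̄ + β/δ`, a reflection in a line: the direction squares to `α/δ`,
    -- and a point on the line is the midpoint of `0` and its image `β/δ`.
    obtain ⟨u, hu⟩ := IsAlgClosed.exists_pow_nat_eq (α / δ) two_pos
    refine ⟨β / (2 * δ), u, ?_, by simpa using hinf, fun z => ?_⟩
    · rw [← hu, norm_pow] at hnorm
      exact (pow_eq_one_iff_of_nonneg (norm_nonneg _) two_ne_zero).1 hnorm
    · rw [hcoe, hu]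
      have h2 : conj (2 : ℂ) = 2 := Complex.conj_ofNat 2
      simp [hδ, h2]
      field_simp
      linear_combination h01
  · left
    have hγ' : conj γ ≠ 0 := by simpa using hγ
    -- An off-diagonal entry of `A Ā` vanishes, so the pole coincides with the image `α/γ` of `∞`:
    -- this is the centre.
    have hpole : ∀ z : ℂ, γ * conj z + δ = γ * conj (z - α / γ) := by
      intro z
      simp
      field_simp
      linear_combination h10
    refine ⟨α / γ, √r / ‖γ‖, by positivity, by simpa [hγ] using hinf, ?_, fun z hz => ?_⟩
    · rw [hcoe, hpole]
      simp
    · have hz' : conj (z - α / γ) ≠ 0 := (_root_.map_ne_zero _).2 (sub_ne_zero.2 hz)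
      rw [hcoe, if_neg (by rw [hpole]; exact mul_ne_zero hγ hz')]
      congr 1
      rw [EuclideanGeometry.inversion, dist_eq_norm, div_pow, div_pow, Real.sq_sqrt hr.le,
        vsub_eq_sub, vadd_eq_add, Complex.real_smul]
      push_cast
      have hzz : z - α / γ ≠ 0 := sub_ne_zero.2 hz
      rw [← Complex.mul_conj' (z - α / γ), ← Complex.mul_conj' γ, hpole]
      have hnum : α * conj z + β = α * conj (z - α / γ) + r / conj γ := by
        simp
        field_simp
        linear_combination h00
      rw [hnum]
      generalize conj (z - α / γ) = x at *
      generalize z - α / γ = y at *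
      field_simp
      ring

/-! ## The upper half-plane -/

/-- The action of a real matrix of determinant `±1` on `LorentzSpace 2`, obtained by identifying
the latter with the symmetric matrices `S` and letting the matrix act by `S ↦ A S Aᵀ`. -/
noncomputable def halfPlaneMatrix (a b c d : ℝ) : Matrix (Fin 3) (Fin 3) ℝ :=
  !![(a ^ 2 + b ^ 2 + c ^ 2 + d ^ 2) / 2, (a ^ 2 - b ^ 2 + c ^ 2 - d ^ 2) / 2, a * b + c * d;
    (a ^ 2 + b ^ 2 - c ^ 2 - d ^ 2) / 2, (a ^ 2 - b ^ 2 - c ^ 2 + d ^ 2) / 2, a * b - c * d;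
    a * c + b * d, a * c - b * d, a * d + b * c]

theorem lorentzMap_halfPlaneMatrix_apply (a b c d : ℝ) (v : LorentzSpace 2) :
    lorentzMap (halfPlaneMatrix a b c d) v =
      ![(a ^ 2 + b ^ 2 + c ^ 2 + d ^ 2) / 2 * v 0 + (a ^ 2 - b ^ 2 + c ^ 2 - d ^ 2) / 2 * v 1
          + (a * b + c * d) * v 2,
        (a ^ 2 + b ^ 2 - c ^ 2 - d ^ 2) / 2 * v 0 + (a ^ 2 - b ^ 2 - c ^ 2 + d ^ 2) / 2 * v 1
          + (a * b - c * d) * v 2,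
        (a * c + b * d) * v 0 + (a * c - b * d) * v 1 + (a * d + b * c) * v 2] := by
  rw [lorentzMap_apply]
  simp [halfPlaneMatrix]

/-- The action is the symmetric square: if `A` has eigenvalues `λ, μ`, it has `λ², λμ = ε, μ²`, and
`λ² + μ² = (a + d)² - 2ε`. -/
theorem charpoly_halfPlaneMatrix {a b c d ε : ℝ} (h : a * d - b * c = ε) (hε : ε ^ 2 = 1) :
    (lorentzMap (halfPlaneMatrix a b c d)).charpoly =
      (X - C ε) * (X ^ 2 - C ((a + d) ^ 2 - 2 * ε) * X + 1) := by
  subst h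
  apply charpoly_lorentzMap
  · simp [halfPlaneMatrix]
    ring
  · simp [halfPlaneMatrix]
    linear_combination hε
  · simp [halfPlaneMatrix, Matrix.det_fin_three]
    linear_combination (a * d - b * c) * hε

theorem isLorentzIsometry_halfPlaneMatrix {a b c d : ℝ} (h : (a * d - b * c) ^ 2 = 1) :
    IsLorentzIsometry (lorentzMap (halfPlaneMatrix a b c d)) := by
  refine isLorentzIsometry_of_lorentzForm (a := (a ^ 2 + b ^ 2 + c ^ 2 + d ^ 2) / 2)
    (b := (a ^ 2 - b ^ 2 + c ^ 2 - d ^ 2) / 2) (c := a * b + c * d) (fun v => ?_) (fun v => ?_)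
    ?_ ?_
  · rw [lorentzForm_two, lorentzForm_two, lorentzMap_halfPlaneMatrix_apply]
    simp
    linear_combination (v 0 ^ 2 - v 1 ^ 2 - v 2 ^ 2) * h
  · rw [lorentzMap_halfPlaneMatrix_apply]
    simp
  · linear_combination h
  · have h1 : 1 ≤ ((a ^ 2 + b ^ 2 + c ^ 2 + d ^ 2) / 2) ^ 2 := by
      nlinarith [sq_nonneg ((a ^ 2 - b ^ 2 + c ^ 2 - d ^ 2) / 2), sq_nonneg (a * b + c * d)]
    refine lt_of_le_of_ne (by positivity) fun h0 => ?_
    rw [← h0] at h1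
    norm_num at h1

/-- The sign of the determinant determines whether the imaginary part changes its sign. -/
theorem det_mul_im_eq {a b c d ε x y u v : ℝ} (h : a * d - b * c = ε)
    (hε : ε ^ 2 = 1) (hy : 0 < y) (hv : 0 < v) {η : ℝ} (hη : η ^ 2 = y ^ 2)
    (hre : u * (c * x + d) - v * (c * η) = a * x + b)
    (him : u * (c * η) + v * (c * x + d) = a * η) :
    ε * η = y ∧ v * ((c * x + d) ^ 2 + c ^ 2 * y ^ 2) = y := by
  -- With `ζ = x + ηi` and `w = u + vi`, the hypotheses are the real and imaginary parts of `w(cζ +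
  -- d) = aζ + b`, and this is `Im w · |cζ + d|² = det · Im ζ`. Allowing `η = ±y` covers both
  -- orientations.
  have hn : v * ((c * x + d) ^ 2 + c ^ 2 * y ^ 2) = ε * η := by
    rw [← hη]
    linear_combination (c * x + d) * him - c * η * hre + η * h
  have hεη : ε * η = y := by
    refine (pow_left_inj₀ ?_ hy.le two_ne_zero).1 (by rw [mul_pow, hε, hη, one_mul])
    rw [← hn]
    positivity
  exact ⟨hεη, hn.trans hεη⟩

/-- Compatibility of `halfPlaneMatrix` with the action `x + η i ↦ u + v i` of the matrix. -/
theorem lorentzMap_halfPlaneMatrix_toLorentz {a b c d ε x y u v : ℝ} (h : a * d - b * c = ε)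
    (hε : ε ^ 2 = 1) (hy : 0 < y) (hv : 0 < v) {η : ℝ} (hη : η ^ 2 = y ^ 2)
    (hre : u * (c * x + d) - v * (c * η) = a * x + b)
    (him : u * (c * η) + v * (c * x + d) = a * η) :
    ![(u ^ 2 + v ^ 2 + 1) / (2 * v), (u ^ 2 + v ^ 2 - 1) / (2 * v), u / v] =
      lorentzMap (halfPlaneMatrix a b c d)
        ![(x ^ 2 + y ^ 2 + 1) / (2 * y), (x ^ 2 + y ^ 2 - 1) / (2 * y), x / y] := by
  have hn := (det_mul_im_eq h hε hy hv hη hre him).2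
  have hu : u * ((c * x + d) ^ 2 + c ^ 2 * y ^ 2) = (a * x + b) * (c * x + d) + a * c * y ^ 2 := by
    rw [← hη]
    linear_combination (c * x + d) * hre + c * η * him
  have huv : (u ^ 2 + v ^ 2) * ((c * x + d) ^ 2 + c ^ 2 * y ^ 2) =
      (a * x + b) ^ 2 + a ^ 2 * y ^ 2 := by
    rw [← hη]
    linear_combination (u * (c * x + d) - v * (c * η) + (a * x + b)) * hre +
      (u * (c * η) + v * (c * x + d) + a * η) * him
  -- The quantities `1/v`, `u/v`, `|w|²/v` are the entries of the symmetric matrix attached to `w`.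
  have e1 : 1 / v = ((c * x + d) ^ 2 + c ^ 2 * y ^ 2) / y := by
    rw [div_eq_div_iff hv.ne' hy.ne']
    linear_combination -hn
  have e2 : u / v = ((a * x + b) * (c * x + d) + a * c * y ^ 2) / y := by
    rw [← hu, div_eq_mul_one_div, e1, mul_div_assoc]
  have e3 : (u ^ 2 + v ^ 2) / v = ((a * x + b) ^ 2 + a ^ 2 * y ^ 2) / y := by
    rw [← huv, div_eq_mul_one_div, e1, mul_div_assoc]
  have f1 : (u ^ 2 + v ^ 2 + 1) / (2 * v) = ((u ^ 2 + v ^ 2) / v + 1 / v) / 2 := by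
    field_simp
  have f2 : (u ^ 2 + v ^ 2 - 1) / (2 * v) = ((u ^ 2 + v ^ 2) / v - 1 / v) / 2 := by
    field_simp
  rw [f1, f2, e1, e2, e3, lorentzMap_halfPlaneMatrix_apply]
  ext i
  fin_cases i <;> simp <;> field_simp <;> ring

theorem exists_fixed_halfPlaneMatrix {a b c d : ℝ} (h : a * d - b * c = 1)
    (hlt : (a + d) ^ 2 - 2 < 2) :
    ∃ v : LorentzSpace 2, 0 < lorentzForm v ∧ lorentzMap (halfPlaneMatrix a b c d) v = v := by
  -- This is the symmetric matrix `-A₀J`, with `A₀` the traceless part of `A` and `J` the standard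
  -- symplectic matrix. It is fixed because `J Aᵀ = A⁻¹ J`, and its form is `1 - (a + d)²/4`.
  refine ⟨![(b - c) / 2, (b + c) / 2, (d - a) / 2], ?_, ?_⟩
  · rw [lorentzForm_two]
    simp
    nlinarith
  · rw [lorentzMap_halfPlaneMatrix_apply]
    ext i
    fin_cases i
    · simp
      linear_combination (b - c) / 2 * h
    · simp
      linear_combination (b + c) / 2 * h
    · simp
      linear_combination (d - a) / 2 * h

theorem exists_fixed_halfPlaneMatrix_of_reversing {a b c d : ℝ} (h : a * d - b * c = -1)
    (htr : a + d = 0) :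
    ∃ v : LorentzSpace 2, 0 < lorentzForm v ∧ lorentzMap (halfPlaneMatrix a b c d) v = v := by
  obtain rfl : d = -a := by linarith
  -- Here `A² = 1`, so `S ↦ A S Aᵀ` is an involution and fixes `I + A Aᵀ`, which is positive
  -- definite.
  refine ⟨![(2 + 2 * a ^ 2 + b ^ 2 + c ^ 2) / 2, (b ^ 2 - c ^ 2) / 2, a * (c - b)], ?_, ?_⟩
  · rw [lorentzForm_two]
    simp
    have : b * c = 1 - a ^ 2 := by linarith
    nlinarith [sq_nonneg (b - c), sq_nonneg (b + c), sq_nonneg a]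
  · rw [lorentzMap_halfPlaneMatrix_apply]
    have hbc : b * c = 1 - a ^ 2 := by linarith
    ext i
    fin_cases i
    · simp
      grind
    · simp
      grind
    · simp
      grind

/-- Normal form of the real matrices. -/
theorem exists_eq_smul_of_mem_lifts_upperHalfPlane {A : GL (Fin 2) ℂ}
    (hA : A ∈ PlaneModel.upperHalfPlane.lifts) :
    ∃ t a b c d ε : ℝ, 0 < t ∧ a * d - b * c = ε ∧ (ε = 1 ∨ ε = -1) ∧
      (A : Matrix (Fin 2) (Fin 2) ℂ) = (t : ℂ) • !![(a : ℂ), (b : ℂ); (c : ℂ), (d : ℂ)] := by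
  obtain ⟨g, rfl⟩ := hA
  have hdet := g.det_ne_zero
  have ht : 0 < √|det (g : Matrix (Fin 2) (Fin 2) ℝ)| := Real.sqrt_pos.2 (abs_pos.2 hdet)
  have ht2 := Real.sq_sqrt (abs_nonneg (det (g : Matrix (Fin 2) (Fin 2) ℝ)))
  set t := √|det (g : Matrix (Fin 2) (Fin 2) ℝ)|
  refine ⟨t, g 0 0 / t, g 0 1 / t, g 1 0 / t, g 1 1 / t, _, ht, rfl, ?_, ?_⟩
  · have : g 0 0 / t * (g 1 1 / t) - g 0 1 / t * (g 1 0 / t) =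
        det (g : Matrix (Fin 2) (Fin 2) ℝ) / |det (g : Matrix (Fin 2) (Fin 2) ℝ)| := by
      rw [← ht2, det_fin_two]
      field_simp
    rw [this]
    rcases hdet.lt_or_gt with h | h
    · right
      rw [abs_of_neg h, div_neg, div_self hdet]
    · left
      rw [abs_of_pos h, div_self hdet]
  · have ht' : (t : ℂ) ≠ 0 := by exact_mod_cast ht.ne'
    ext i j
    fin_cases i <;> fin_cases j <;> simp [mul_div_cancel₀ _ ht']

/-! ## The disk -/

/-- The action of the matrix with rows `(a, c̄)`, `(c, ā)`, where `a = a₁ + a₂ i` and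
`c = c₁ + c₂ i`, on `LorentzSpace 2`, preceded by the reflection `v₂ ↦ κ v₂`, `κ = ±1`. -/
noncomputable def diskMatrix (a₁ a₂ c₁ c₂ κ : ℝ) : Matrix (Fin 3) (Fin 3) ℝ :=
  !![a₁ ^ 2 + a₂ ^ 2 + c₁ ^ 2 + c₂ ^ 2, 2 * (a₁ * c₁ - a₂ * c₂),
      -(2 * (a₁ * c₂ + a₂ * c₁)) * κ;
    2 * (a₁ * c₁ + a₂ * c₂), a₁ ^ 2 - a₂ ^ 2 + c₁ ^ 2 - c₂ ^ 2,
      (-(2 * a₁ * a₂) - 2 * c₁ * c₂) * κ;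
    2 * (a₂ * c₁ - a₁ * c₂), 2 * a₁ * a₂ - 2 * c₁ * c₂,
      (a₁ ^ 2 - a₂ ^ 2 - c₁ ^ 2 + c₂ ^ 2) * κ]

theorem lorentzMap_diskMatrix_apply (a₁ a₂ c₁ c₂ κ : ℝ) (v : LorentzSpace 2) :
    lorentzMap (diskMatrix a₁ a₂ c₁ c₂ κ) v =
      ![(a₁ ^ 2 + a₂ ^ 2 + c₁ ^ 2 + c₂ ^ 2) * v 0 + 2 * (a₁ * c₁ - a₂ * c₂) * v 1
          + -(2 * (a₁ * c₂ + a₂ * c₁)) * κ * v 2,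
        2 * (a₁ * c₁ + a₂ * c₂) * v 0 + (a₁ ^ 2 - a₂ ^ 2 + c₁ ^ 2 - c₂ ^ 2) * v 1
          + (-(2 * a₁ * a₂) - 2 * c₁ * c₂) * κ * v 2,
        2 * (a₂ * c₁ - a₁ * c₂) * v 0 + (2 * a₁ * a₂ - 2 * c₁ * c₂) * v 1
          + (a₁ ^ 2 - a₂ ^ 2 - c₁ ^ 2 + c₂ ^ 2) * κ * v 2] := by
  rw [lorentzMap_apply]
  simp [diskMatrix]

variable {a₁ a₂ c₁ c₂ : ℝ}

theorem charpoly_diskMatrix_one (h : a₁ ^ 2 + a₂ ^ 2 - (c₁ ^ 2 + c₂ ^ 2) = 1) :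
    (lorentzMap (diskMatrix a₁ a₂ c₁ c₂ 1)).charpoly =
      (X - C 1) * (X ^ 2 - C (4 * a₁ ^ 2 - 2) * X + 1) := by
  apply charpoly_lorentzMap
  · simp [diskMatrix]
    linear_combination -h
  · simp [diskMatrix]
    linear_combination (3 * a₁ ^ 2 - a₂ ^ 2 + c₁ ^ 2 + c₂ ^ 2 - 1) * h
  · simp [diskMatrix, Matrix.det_fin_three]
    have h3 : (a₁ ^ 2 + a₂ ^ 2 - (c₁ ^ 2 + c₂ ^ 2)) ^ 3 = 1 := by rw [h]; norm_num
    linear_combination h3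

/-- The number `4c₁² + 2` is the trace of `A Ā` for the normalised `A`, the matrix inducing the
square of the isometry. -/
theorem charpoly_diskMatrix_neg_one (h : a₁ ^ 2 + a₂ ^ 2 - (c₁ ^ 2 + c₂ ^ 2) = 1) :
    (lorentzMap (diskMatrix a₁ a₂ c₁ c₂ (-1))).charpoly =
      (X - C (-1)) * (X ^ 2 - C (4 * c₁ ^ 2 + 2) * X + 1) := by
  apply charpoly_lorentzMap
  · simp [diskMatrix]
    linear_combination h
  · simp [diskMatrix]
    linear_combination (-3 * c₁ ^ 2 + c₂ ^ 2 - a₁ ^ 2 - a₂ ^ 2 - 1) * h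
  · simp [diskMatrix, Matrix.det_fin_three]
    have h3 : (a₁ ^ 2 + a₂ ^ 2 - (c₁ ^ 2 + c₂ ^ 2)) ^ 3 = 1 := by rw [h]; norm_num
    linear_combination -h3

theorem isLorentzIsometry_diskMatrix {κ : ℝ} (h : a₁ ^ 2 + a₂ ^ 2 - (c₁ ^ 2 + c₂ ^ 2) = 1)
    (hκ : κ ^ 2 = 1) : IsLorentzIsometry (lorentzMap (diskMatrix a₁ a₂ c₁ c₂ κ)) := by
  have h2 : (a₁ ^ 2 + a₂ ^ 2 - (c₁ ^ 2 + c₂ ^ 2)) ^ 2 = 1 := by rw [h]; norm_num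
  refine isLorentzIsometry_of_lorentzForm (a := a₁ ^ 2 + a₂ ^ 2 + c₁ ^ 2 + c₂ ^ 2)
    (b := 2 * (a₁ * c₁ - a₂ * c₂)) (c := -(2 * (a₁ * c₂ + a₂ * c₁)) * κ) (fun v => ?_)
    (fun v => ?_) ?_ ?_
  · rw [lorentzForm_two, lorentzForm_two, lorentzMap_diskMatrix_apply]
    simp
    linear_combination (v 0 ^ 2 - v 1 ^ 2 - κ ^ 2 * v 2 ^ 2) * h2 - v 2 ^ 2 * hκ
  · rw [lorentzMap_diskMatrix_apply]
    simp
  · linear_combination h2 - (2 * (a₁ * c₂ + a₂ * c₁)) ^ 2 * hκ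
  · nlinarith [sq_nonneg c₁, sq_nonneg c₂]

/-- Compatibility of `diskMatrix` with the action `x + κ y i ↦ u + v i` of the matrix. -/
theorem lorentzMap_diskMatrix_toLorentz {κ x y u v : ℝ}
    (h : a₁ ^ 2 + a₂ ^ 2 - (c₁ ^ 2 + c₂ ^ 2) = 1) (hκ : κ ^ 2 = 1)
    (hxy : x ^ 2 + y ^ 2 < 1) (huv : u ^ 2 + v ^ 2 < 1)
    (hre : u * (c₁ * x - c₂ * (κ * y) + a₁) - v * (c₁ * (κ * y) + c₂ * x - a₂) =
      a₁ * x - a₂ * (κ * y) + c₁)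
    (him : u * (c₁ * (κ * y) + c₂ * x - a₂) + v * (c₁ * x - c₂ * (κ * y) + a₁) =
      a₁ * (κ * y) + a₂ * x - c₂) :
    ![(1 + (u ^ 2 + v ^ 2)) / (1 - (u ^ 2 + v ^ 2)), 2 * u / (1 - (u ^ 2 + v ^ 2)),
        2 * v / (1 - (u ^ 2 + v ^ 2))] =
      lorentzMap (diskMatrix a₁ a₂ c₁ c₂ κ)
        ![(1 + (x ^ 2 + y ^ 2)) / (1 - (x ^ 2 + y ^ 2)), 2 * x / (1 - (x ^ 2 + y ^ 2)),
          2 * y / (1 - (x ^ 2 + y ^ 2))] := by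
  obtain ⟨η, hη⟩ : ∃ η, η = κ * y := ⟨_, rfl⟩
  have hy2 : y ^ 2 = η ^ 2 := by rw [hη, mul_pow, hκ, one_mul]
  obtain ⟨n₁, hn₁⟩ : ∃ n₁, n₁ = c₁ * x - c₂ * η + a₁ := ⟨_, rfl⟩
  obtain ⟨n₂, hn₂⟩ : ∃ n₂, n₂ = c₁ * η + c₂ * x - a₂ := ⟨_, rfl⟩
  rw [← hη, ← hn₁, ← hn₂] at hre him
  have huv' : (u ^ 2 + v ^ 2) * (n₁ ^ 2 + n₂ ^ 2) =
      (a₁ * x - a₂ * η + c₁) ^ 2 + (a₁ * η + a₂ * x - c₂) ^ 2 := by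
    rw [← hre, ← him]
    ring
  -- The `SU(1,1)` identity `(1 - |w|²)|cζ + ā|² = 1 - |ζ|²`, where `ζ = x + κyi` and `n₁ + n₂ i` is
  -- the denominator.
  have hn : (1 - (u ^ 2 + v ^ 2)) * (n₁ ^ 2 + n₂ ^ 2) = 1 - (x ^ 2 + y ^ 2) := by
    rw [sub_mul, huv', hn₁, hn₂, hy2]
    linear_combination (1 - (x ^ 2 + η ^ 2)) * h
  have hD : 0 < 1 - (x ^ 2 + y ^ 2) := by linarith
  have hE : 0 < 1 - (u ^ 2 + v ^ 2) := by linarith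
  have e1 : 1 / (1 - (u ^ 2 + v ^ 2)) = (n₁ ^ 2 + n₂ ^ 2) / (1 - (x ^ 2 + y ^ 2)) := by
    rw [div_eq_div_iff hE.ne' hD.ne']
    linear_combination -hn
  have e0 : (1 + (u ^ 2 + v ^ 2)) / (1 - (u ^ 2 + v ^ 2)) =
      ((n₁ ^ 2 + n₂ ^ 2) + ((a₁ * x - a₂ * η + c₁) ^ 2 + (a₁ * η + a₂ * x - c₂) ^ 2)) /
        (1 - (x ^ 2 + y ^ 2)) := by
    rw [← huv', div_eq_mul_one_div, e1]
    ring
  have e2 : 2 * u / (1 - (u ^ 2 + v ^ 2)) =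
      2 * ((a₁ * x - a₂ * η + c₁) * n₁ + (a₁ * η + a₂ * x - c₂) * n₂) /
        (1 - (x ^ 2 + y ^ 2)) := by
    rw [← hre, ← him, div_eq_mul_one_div, e1]
    ring
  have e3 : 2 * v / (1 - (u ^ 2 + v ^ 2)) =
      2 * ((a₁ * η + a₂ * x - c₂) * n₁ - (a₁ * x - a₂ * η + c₁) * n₂) /
        (1 - (x ^ 2 + y ^ 2)) := by
    rw [← hre, ← him, div_eq_mul_one_div, e1]
    ring
  have hκy : ∀ r : ℝ, r * κ * (2 * y / (1 - (x ^ 2 + y ^ 2))) =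
      r * (2 * η / (1 - (x ^ 2 + y ^ 2))) := by
    intro r
    rw [hη]
    ring
  rw [e0, e2, e3, lorentzMap_diskMatrix_apply]
  ext i
  fin_cases i <;> simp [hκy] <;> field_simp <;> rw [hn₁, hn₂, hy2] <;> ring

theorem exists_fixed_diskMatrix (h : a₁ ^ 2 + a₂ ^ 2 - (c₁ ^ 2 + c₂ ^ 2) = 1)
    (hlt : 4 * a₁ ^ 2 - 2 < 2) :
    ∃ v : LorentzSpace 2, 0 < lorentzForm v ∧ lorentzMap (diskMatrix a₁ a₂ c₁ c₂ 1) v = v := by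
  -- The vector encodes the traceless part of the matrix; its form is `1 - a₁²`.
  refine ⟨![a₂, c₂, c₁], ?_, ?_⟩
  · rw [lorentzForm_two]
    simp
    nlinarith
  · rw [lorentzMap_diskMatrix_apply]
    ext i
    fin_cases i
    · simp
      linear_combination a₂ * h
    · simp
      linear_combination c₂ * h
    · simp
      linear_combination c₁ * h

theorem exists_fixed_diskMatrix_of_reversing (h : a₁ ^ 2 + a₂ ^ 2 - (c₁ ^ 2 + c₂ ^ 2) = 1)
    (hc : c₁ = 0) :
    ∃ v : LorentzSpace 2, 0 < lorentzForm v ∧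
      lorentzMap (diskMatrix a₁ a₂ c₁ c₂ (-1)) v = v := by
  subst hc
  -- For `c₁ = 0` the map is an involution, and this is the midpoint of the base point `(1, 0, 0)`
  -- and its image.
  refine ⟨![a₁ ^ 2 + a₂ ^ 2, a₂ * c₂, -(a₁ * c₂)], ?_, ?_⟩
  · rw [lorentzForm_two]
    simp
    have : 0 < a₁ ^ 2 + a₂ ^ 2 := by nlinarith [sq_nonneg c₂]
    nlinarith
  · rw [lorentzMap_diskMatrix_apply]
    ext i
    fin_cases i
    · simp
      linear_combination (a₁ ^ 2 + a₂ ^ 2) * h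
    · simp
      linear_combination (a₂ * c₂) * h
    · simp
      linear_combination (-a₁ * c₂) * h

/-- Normal form of the matrices in `ℝ₊ × SU(1,1)`. -/
theorem exists_eq_smul_of_mem_lifts_disk {A : GL (Fin 2) ℂ} (hA : A ∈ PlaneModel.disk.lifts) :
    ∃ t a₁ a₂ c₁ c₂ : ℝ, 0 < t ∧ a₁ ^ 2 + a₂ ^ 2 - (c₁ ^ 2 + c₂ ^ 2) = 1 ∧
      (A : Matrix (Fin 2) (Fin 2) ℂ) = (t : ℂ) • !![(⟨a₁, a₂⟩ : ℂ), (⟨c₁, -c₂⟩ : ℂ);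
        (⟨c₁, c₂⟩ : ℂ), (⟨a₁, -a₂⟩ : ℂ)] := by
  obtain ⟨t, a, c, ht, h, hA⟩ := hA
  rw [Complex.sq_norm, Complex.sq_norm, Complex.normSq_apply, Complex.normSq_apply] at h
  exact ⟨t, a.re, a.im, c.re, c.im, ht, by linear_combination h, hA⟩

/-! ## The Lorentz isometries induced by matrices -/

theorem mul_eq_of_smul_coe_eq_coe {A : GL (Fin 2) ℂ} {t : ℝ} {α β γ δ z w : ℂ} (ht : 0 < t)
    (hA : (A : Matrix (Fin 2) (Fin 2) ℂ) = (t : ℂ) • !![α, β; γ, δ])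
    (h : A • (z : OnePoint ℂ) = w) : w * (γ * z + δ) = α * z + β := by
  have ht' : (t : ℂ) ≠ 0 := by exact_mod_cast ht.ne'
  have h00 : A 0 0 = t * α := by rw [hA]; simp
  have h01 : A 0 1 = t * β := by rw [hA]; simp
  have h10 : A 1 0 = t * γ := by rw [hA]; simp
  have h11 : A 1 1 = t * δ := by rw [hA]; simp
  rw [smul_some_eq_ite, h00, h01, h10, h11] at h
  split_ifs at h with h0
  · exact absurd h (infty_ne_coe w)
  · rw [coe_eq_coe, div_eq_iff h0] at h
    apply mul_left_cancel₀ ht'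
    linear_combination -h

theorem eq_one_of_lorentzMap_eq_one {N : Matrix (Fin 3) (Fin 3) ℝ} (h : lorentzMap N = 1) :
    N = 1 := by
  apply Matrix.toLin'.injective
  rw [Matrix.toLin'_one]
  exact h

theorem eq_scalar_of_halfPlaneMatrix {t a b c d : ℝ} (h : a * d - b * c = 1)
    (hT : lorentzMap (halfPlaneMatrix a b c d) = 1) :
    ∃ μ : ℝ, ((t : ℂ) • !![(a : ℂ), (b : ℂ); (c : ℂ), (d : ℂ)] : Matrix (Fin 2) (Fin 2) ℂ) =
      (μ : ℂ) • 1 := by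
  have hN := eq_one_of_lorentzMap_eq_one hT
  have h00 := congrFun (congrFun hN 0) 0
  have h11 := congrFun (congrFun hN 1) 1
  simp [halfPlaneMatrix] at h00 h11
  -- The difference of the first two diagonal entries of the `3 × 3` matrix is `b² + c²`.
  have hbc : b ^ 2 + c ^ 2 = 0 := by linarith
  obtain rfl : b = 0 := by nlinarith [sq_nonneg b, sq_nonneg c]
  obtain rfl : c = 0 := by nlinarith [sq_nonneg c]
  obtain rfl : a = d := by
    have : (a - d) ^ 2 = 0 := by linarith
    exact sub_eq_zero.1 (pow_eq_zero_iff two_ne_zero |>.1 this)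
  refine ⟨t * a, ?_⟩
  ext i j
  fin_cases i <;> fin_cases j <;> simp

theorem eq_scalar_of_diskMatrix {t a₁ a₂ c₁ c₂ : ℝ}
    (h : a₁ ^ 2 + a₂ ^ 2 - (c₁ ^ 2 + c₂ ^ 2) = 1)
    (hT : lorentzMap (diskMatrix a₁ a₂ c₁ c₂ 1) = 1) :
    ∃ μ : ℝ, ((t : ℂ) • !![(⟨a₁, a₂⟩ : ℂ), (⟨c₁, -c₂⟩ : ℂ); (⟨c₁, c₂⟩ : ℂ), (⟨a₁, -a₂⟩ : ℂ)] :
      Matrix (Fin 2) (Fin 2) ℂ) = (μ : ℂ) • 1 := by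
  have hN := eq_one_of_lorentzMap_eq_one hT
  have h00 := congrFun (congrFun hN 0) 0
  have h11 := congrFun (congrFun hN 1) 1
  simp [diskMatrix] at h00 h11
  have hc : c₁ ^ 2 + c₂ ^ 2 = 0 := by linarith
  obtain rfl : c₁ = 0 := by nlinarith [sq_nonneg c₁, sq_nonneg c₂]
  obtain rfl : c₂ = 0 := by nlinarith [sq_nonneg c₂]
  obtain rfl : a₂ = 0 := by nlinarith [sq_nonneg a₂]
  refine ⟨t * a₁, ?_⟩
  ext i j
  fin_cases i <;> fin_cases j <;> simp [Complex.ext_iff]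

theorem toLorentz_upperHalfPlane (z : ℂ) : PlaneModel.upperHalfPlane.toLorentz z =
    ![(z.re ^ 2 + z.im ^ 2 + 1) / (2 * z.im), (z.re ^ 2 + z.im ^ 2 - 1) / (2 * z.im),
      z.re / z.im] := by
  rw [PlaneModel.toLorentz, Complex.sq_norm, Complex.normSq_apply, ← sq, ← sq]

theorem toLorentz_disk (z : ℂ) : PlaneModel.disk.toLorentz z =
    ![(1 + (z.re ^ 2 + z.im ^ 2)) / (1 - (z.re ^ 2 + z.im ^ 2)),
      2 * z.re / (1 - (z.re ^ 2 + z.im ^ 2)), 2 * z.im / (1 - (z.re ^ 2 + z.im ^ 2))] := by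
  rw [PlaneModel.toLorentz, Complex.sq_norm, Complex.normSq_apply, ← sq, ← sq]

theorem sq_add_sq_lt_one_of_mem_disk {z : ℂ} (hz : z ∈ PlaneModel.disk.points) :
    z.re ^ 2 + z.im ^ 2 < 1 := by
  have h : ‖z‖ < 1 := hz
  have := pow_lt_one₀ (norm_nonneg z) h two_ne_zero
  rwa [Complex.sq_norm, Complex.normSq_apply, ← sq, ← sq] at this

/-- Collects all that the case distinction needs, so that it can be made without reference to the
model. Here `δ` is the square of the scaling factor. -/
theorem exists_lorentz_of_preserving {M : PlaneModel} {A : GL (Fin 2) ℂ} (hA : A ∈ M.lifts)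
    {f : OnePoint ℂ → OnePoint ℂ} (hf : M.InducesPreserving A f) :
    ∃ (T : Module.End ℝ (LorentzSpace 2)) (σ δ : ℝ), M.ActsAs f T ∧ -2 ≤ σ ∧ δ ≠ 0 ∧
      det (A : Matrix (Fin 2) (Fin 2) ℂ) = δ ∧
      trace (A : Matrix (Fin 2) (Fin 2) ℂ) ^ 2 = ((δ * (σ + 2) : ℝ) : ℂ) ∧
      T.charpoly = (X - C 1) * (X ^ 2 - C σ * X + 1) ∧
      (σ < 2 → ∃ v : LorentzSpace 2, 0 < lorentzForm v ∧ T v = v) ∧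
      (T = 1 → IsRealScalar A) := by
  cases M with
  | upperHalfPlane =>
    obtain ⟨t, a, b, c, d, ε, ht, h, hε, hA⟩ := exists_eq_smul_of_mem_lifts_upperHalfPlane hA
    have hε2 : ε ^ 2 = 1 := by rcases hε with rfl | rfl <;> norm_num
    have key : ∀ {z w : ℂ}, f z = w →
        w.re * (c * z.re + d) - w.im * (c * z.im) = a * z.re + b ∧
        w.re * (c * z.im) + w.im * (c * z.re + d) = a * z.im := by
      intro z w hw
      rw [hf.1] at hw
      have := mul_eq_of_smul_coe_eq_coe ht hA hw
      simpa [Complex.ext_iff] using this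
    -- One point suffices: the image of `i` has positive imaginary part, which fixes the sign of the
    -- determinant.
    have hε1 : ε = 1 := by
      obtain ⟨w, hw, hfw⟩ := hf.2 Complex.I (by simp [PlaneModel.points])
      obtain ⟨hre, him⟩ := key hfw
      simpa using (det_mul_im_eq h hε2 (y := Complex.I.im) (by simp) hw rfl hre him).1
    subst hε1
    refine ⟨_, (a + d) ^ 2 - 2 * 1, t ^ 2, ⟨isLorentzIsometry_halfPlaneMatrix (by rw [h, hε2]), ?_⟩,
      by nlinarith [sq_nonneg (a + d)], by positivity, ?_, ?_, charpoly_halfPlaneMatrix h hε2,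
      fun hlt => exists_fixed_halfPlaneMatrix h (by linarith), fun hT => ?_⟩
    · intro z hz
      obtain ⟨w, hw, hfw⟩ := hf.2 z hz
      obtain ⟨hre, him⟩ := key hfw
      refine ⟨w, hw, hfw, ?_⟩
      rw [toLorentz_upperHalfPlane, toLorentz_upperHalfPlane]
      exact lorentzMap_halfPlaneMatrix_toLorentz h hε2 hz hw rfl hre him
    · have h' : (a * d - b * c : ℂ) = 1 := by exact_mod_cast h
      rw [hA]
      simp [det_fin_two]
      linear_combination t ^ 2 * h'
    · rw [hA]
      simp [trace_fin_two]
      ring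
    · rw [IsRealScalar, hA]
      exact eq_scalar_of_halfPlaneMatrix h hT
  | disk =>
    obtain ⟨t, a₁, a₂, c₁, c₂, ht, h, hA⟩ := exists_eq_smul_of_mem_lifts_disk hA
    refine ⟨_, 4 * a₁ ^ 2 - 2, t ^ 2, ⟨isLorentzIsometry_diskMatrix h (one_pow 2), ?_⟩,
      by nlinarith [sq_nonneg a₁], by positivity, ?_, ?_, charpoly_diskMatrix_one h,
      exists_fixed_diskMatrix h, fun hT => ?_⟩
    · intro z hz
      obtain ⟨w, hw, hfw⟩ := hf.2 z hz
      refine ⟨w, hw, hfw, ?_⟩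
      rw [hf.1] at hfw
      have := mul_eq_of_smul_coe_eq_coe ht hA hfw
      obtain ⟨hre, him⟩ := Complex.ext_iff.1 this
      simp at hre him
      rw [toLorentz_disk, toLorentz_disk]
      exact lorentzMap_diskMatrix_toLorentz h (one_pow 2) (sq_add_sq_lt_one_of_mem_disk hz)
        (sq_add_sq_lt_one_of_mem_disk hw) (by linear_combination hre) (by linear_combination him)
    · rw [hA]
      simp [det_fin_two, Complex.ext_iff, sq]
      exact ⟨by linear_combination t ^ 2 * h, by ring⟩
    · rw [hA]
      simp [trace_fin_two, Complex.ext_iff, sq]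
      ring
    · rw [IsRealScalar, hA]
      exact eq_scalar_of_diskMatrix h hT

open ComplexConjugate in
theorem trace_mul_conjMatrix (A : GL (Fin 2) ℂ) :
    trace ((A * conjMatrix A : GL (Fin 2) ℂ) : Matrix (Fin 2) (Fin 2) ℂ) =
      A 0 0 * conj (A 0 0) + A 0 1 * conj (A 1 0) +
        (A 1 0 * conj (A 0 1) + A 1 1 * conj (A 1 1)) := by
  simp [conjMatrix, trace_fin_two, Matrix.mul_apply, Fin.sum_univ_two]

open ComplexConjugate in
theorem det_mul_conjMatrix (A : GL (Fin 2) ℂ) :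
    det ((A * conjMatrix A : GL (Fin 2) ℂ) : Matrix (Fin 2) (Fin 2) ℂ) =
      det (A : Matrix (Fin 2) (Fin 2) ℂ) * conj (det (A : Matrix (Fin 2) (Fin 2) ℂ)) := by
  rw [Units.val_mul, det_mul]
  simp [conjMatrix, det_fin_two]

/-- The bound `2 ≤ σ` is automatic, since `σ - 2` is `(a + d)²` in the half-plane and `4c₁²` in the
disk. -/
theorem exists_lorentz_of_reversing {M : PlaneModel} {A : GL (Fin 2) ℂ} (hA : A ∈ M.lifts)
    {f : OnePoint ℂ → OnePoint ℂ} (hf : M.InducesReversing A f) :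
    ∃ (T : Module.End ℝ (LorentzSpace 2)) (σ δ : ℝ), M.ActsAs f T ∧ 2 ≤ σ ∧ 0 < δ ∧
      det ((A * conjMatrix A : GL (Fin 2) ℂ) : Matrix (Fin 2) (Fin 2) ℂ) = ((δ ^ 2 : ℝ) : ℂ) ∧
      trace ((A * conjMatrix A : GL (Fin 2) ℂ) : Matrix (Fin 2) (Fin 2) ℂ) =
        ((δ * σ : ℝ) : ℂ) ∧
      T.charpoly = (X - C (-1)) * (X ^ 2 - C σ * X + 1) ∧
      (σ = 2 → ∃ v : LorentzSpace 2, 0 < lorentzForm v ∧ T v = v) := by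
  cases M with
  | upperHalfPlane =>
    obtain ⟨t, a, b, c, d, ε, ht, h, hε, hA⟩ := exists_eq_smul_of_mem_lifts_upperHalfPlane hA
    have hε2 : ε ^ 2 = 1 := by rcases hε with rfl | rfl <;> norm_num
    have key : ∀ {z w : ℂ}, f z = w →
        w.re * (c * z.re + d) - w.im * (c * -z.im) = a * z.re + b ∧
        w.re * (c * -z.im) + w.im * (c * z.re + d) = a * -z.im := by
      intro z w hw
      rw [hf.1, OnePoint.map_some] at hw
      have := mul_eq_of_smul_coe_eq_coe ht hA hw
      simpa [Complex.ext_iff] using this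
    have hε1 : ε = -1 := by
      obtain ⟨w, hw, hfw⟩ := hf.2 Complex.I (by simp [PlaneModel.points])
      obtain ⟨hre, him⟩ := key hfw
      have := (det_mul_im_eq h hε2 (y := Complex.I.im) (by simp) hw (by simp) hre him).1
      simp at this
      linarith
    subst hε1
    refine ⟨_, (a + d) ^ 2 - 2 * (-1), t ^ 2,
      ⟨isLorentzIsometry_halfPlaneMatrix (by rw [h, hε2]), ?_⟩,
      by nlinarith [sq_nonneg (a + d)], by positivity, ?_, ?_, charpoly_halfPlaneMatrix h hε2,
      fun h2 => exists_fixed_halfPlaneMatrix_of_reversing h ?_⟩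
    · intro z hz
      obtain ⟨w, hw, hfw⟩ := hf.2 z hz
      obtain ⟨hre, him⟩ := key hfw
      refine ⟨w, hw, hfw, ?_⟩
      rw [toLorentz_upperHalfPlane, toLorentz_upperHalfPlane]
      exact lorentzMap_halfPlaneMatrix_toLorentz h hε2 hz hw (neg_sq z.im) hre him
    · have h' : (a * d - b * c : ℂ) = -1 := by exact_mod_cast h
      rw [det_mul_conjMatrix, hA]
      simp [det_fin_two]
      linear_combination t ^ 4 * (a * d - b * c - 1) * h'
    · have h' : (a * d - b * c : ℂ) = -1 := by exact_mod_cast h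
      rw [trace_mul_conjMatrix, hA]
      simp
      linear_combination (-2 * t ^ 2) * h'
    · exact pow_eq_zero_iff two_ne_zero |>.1 (by linarith)
  | disk =>
    obtain ⟨t, a₁, a₂, c₁, c₂, ht, h, hA⟩ := exists_eq_smul_of_mem_lifts_disk hA
    refine ⟨_, 4 * c₁ ^ 2 + 2, t ^ 2, ⟨isLorentzIsometry_diskMatrix h neg_one_sq, ?_⟩,
      by nlinarith [sq_nonneg c₁], by positivity, ?_, ?_, charpoly_diskMatrix_neg_one h,
      fun h2 => exists_fixed_diskMatrix_of_reversing h ?_⟩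
    · intro z hz
      obtain ⟨w, hw, hfw⟩ := hf.2 z hz
      refine ⟨w, hw, hfw, ?_⟩
      rw [hf.1, OnePoint.map_some] at hfw
      have := mul_eq_of_smul_coe_eq_coe ht hA hfw
      obtain ⟨hre, him⟩ := Complex.ext_iff.1 this
      simp at hre him
      rw [toLorentz_disk, toLorentz_disk]
      exact lorentzMap_diskMatrix_toLorentz h neg_one_sq (sq_add_sq_lt_one_of_mem_disk hz)
        (sq_add_sq_lt_one_of_mem_disk hw) (by linear_combination hre) (by linear_combination him)
    · have hd : det (A : Matrix (Fin 2) (Fin 2) ℂ) = ((t ^ 2 : ℝ) : ℂ) := by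
        rw [hA]
        simp [det_fin_two, Complex.ext_iff, sq]
        exact ⟨by linear_combination t ^ 2 * h, by ring⟩
      rw [det_mul_conjMatrix, hd, Complex.conj_ofReal]
      push_cast
      ring
    · rw [trace_mul_conjMatrix, hA]
      simp [Complex.ext_iff, sq]
      exact ⟨by linear_combination 2 * t ^ 2 * h, by ring⟩
    · exact pow_eq_zero_iff two_ne_zero |>.1 (by linarith)

/-- The Jordan form requires `A` not to be a complex scalar, while the theorem excludes only real
ones. In the disk the diagonal entries are conjugate, so a scalar is real. -/
theorem isRealScalar_of_mem_lifts {M : PlaneModel} {A : GL (Fin 2) ℂ} (hA : A ∈ M.lifts) {μ : ℂ}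
    (h : (A : Matrix (Fin 2) (Fin 2) ℂ) = μ • 1) : IsRealScalar A := by
  suffices hμ : μ.im = 0 by
    refine ⟨μ.re, ?_⟩
    rw [h]
    congr 1
    exact Complex.ext rfl (by simpa using hμ)
  cases M with
  | upperHalfPlane =>
    obtain ⟨t, a, b, c, d, ε, ht, -, -, hA⟩ := exists_eq_smul_of_mem_lifts_upperHalfPlane hA
    have h00 := congrFun (congrFun (hA.symm.trans h) 0) 0
    have := congrArg Complex.im h00
    simpa using this.symm
  | disk =>
    obtain ⟨t, a₁, a₂, c₁, c₂, ht, -, hA⟩ := exists_eq_smul_of_mem_lifts_disk hA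
    have h00 := congrArg Complex.im (congrFun (congrFun (hA.symm.trans h) 0) 0)
    have h11 := congrArg Complex.im (congrFun (congrFun (hA.symm.trans h) 1) 1)
    simp at h00 h11
    linarith

theorem im_cInv_of_mem_lifts {M : PlaneModel} {A : GL (Fin 2) ℂ} (hA : A ∈ M.lifts) :
    (cInv A).im = 0 := by
  suffices h : ∃ τ δ : ℝ, trace (A : Matrix (Fin 2) (Fin 2) ℂ) = τ ∧
      det (A : Matrix (Fin 2) (Fin 2) ℂ) = δ by
    obtain ⟨τ, δ, hτ, hδ⟩ := h
    rw [cInv, hτ, hδ]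
    norm_cast
  cases M with
  | upperHalfPlane =>
    obtain ⟨t, a, b, c, d, ε, ht, -, -, hA⟩ := exists_eq_smul_of_mem_lifts_upperHalfPlane hA
    refine ⟨t * (a + d), t ^ 2 * (a * d - b * c), ?_, ?_⟩
    · rw [hA]
      simp [trace_fin_two]
      ring
    · rw [hA]
      simp [det_fin_two]
      ring
  | disk =>
    obtain ⟨t, a₁, a₂, c₁, c₂, ht, -, hA⟩ := exists_eq_smul_of_mem_lifts_disk hA
    refine ⟨t * (2 * a₁), t ^ 2 * (a₁ ^ 2 + a₂ ^ 2 - (c₁ ^ 2 + c₂ ^ 2)), ?_, ?_⟩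
    · rw [hA]
      simp [trace_fin_two, Complex.ext_iff]
      ring
    · rw [hA]
      simp [det_fin_two, Complex.ext_iff, sq]
      exact ⟨by ring, by ring⟩

end Hyperbolic

/-! ### The case distinction on `σ` -/

theorem corollaryA2 (M : Hyperbolic.PlaneModel) (A : Matrix.GeneralLinearGroup (Fin 2) ℂ)
    (hA : A ∈ M.lifts) :
    -- `c(A)` is real
    (Hyperbolic.cInv A).im = 0 ∧
    -- the orientation-preserving case
    (∀ f : OnePoint ℂ → OnePoint ℂ, M.InducesPreserving A f →
      (‖Hyperbolic.cInv A - 2‖ < 2 → M.IsElliptic 1 f) ∧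
      (2 < ‖Hyperbolic.cInv A - 2‖ → M.IsStretch f) ∧
      (Hyperbolic.cInv A = 0 → M.IsHalfTurn f) ∧
      (‖Hyperbolic.cInv A - 2‖ = 2 → Hyperbolic.cInv A ≠ 0 →
        ¬ Hyperbolic.IsRealScalar A → M.IsTranslation f) ∧
      (‖Hyperbolic.cInv A - 2‖ = 2 → Hyperbolic.IsRealScalar A → f = id)) ∧
    -- the orientation-reversing case, with `B = A Ā`
    (∀ (f : OnePoint ℂ → OnePoint ℂ) (B : Matrix.GeneralLinearGroup (Fin 2) ℂ),
      M.InducesReversing A f → B = A * Hyperbolic.conjMatrix A →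
      (2 < ‖Hyperbolic.cInv B - 2‖ → M.IsHyperbolicInversion 0 f) ∧
      (¬ Hyperbolic.IsRealScalar B → ‖Hyperbolic.cInv B - 2‖ < 2 →
        M.IsEllipticInversion 1 f) ∧
      (Hyperbolic.IsRealScalar B →
        M.IsEllipticInversion 0 f ∧ Hyperbolic.IsCircleInversion f)) := by
  refine ⟨Hyperbolic.im_cInv_of_mem_lifts hA, fun f hf => ?_, fun f B hf hB => ?_⟩
  · obtain ⟨T, σ, δ, hact, hσ, hδ, hdet, htr, hchar, hfix, hone⟩ :=
      Hyperbolic.exists_lorentz_of_preserving hA hf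
    have hδ' : (δ : ℂ) ≠ 0 := by exact_mod_cast hδ
    have hc : Hyperbolic.cInv A = ((σ + 2 : ℝ) : ℂ) := by
      rw [Hyperbolic.cInv, hdet, htr]
      push_cast
      field_simp
    have hnorm : ‖Hyperbolic.cInv A - 2‖ = |σ| := by
      rw [hc, show (((σ + 2 : ℝ) : ℂ) - 2) = σ by push_cast; ring, Complex.norm_real,
        Real.norm_eq_abs]
    rw [hnorm]
    refine ⟨fun h => ⟨T, hact, ?_⟩, fun h => ?_, fun h => ?_, fun h h0 hns => ?_, fun _ h => ?_⟩
    · have := (abs_lt.1 h).2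
      exact Hyperbolic.ellipticType_one_of_charpoly hchar hσ this (hfix this)
    · have h2 : 2 < σ := by
        rcases lt_abs.1 h with h | h <;> linarith
      obtain ⟨r, hr, hrσ⟩ := Hyperbolic.exists_add_inv_eq h2
      have hr0 : r ≠ 0 := by linarith
      refine ⟨⟨T, hact, Hyperbolic.hyperbolicType_zero_of_charpoly hchar h2⟩, ?_⟩
      -- The stretch factor is the Lorentz eigenvalue `r`, because `c(A) = σ + 2 = r + 2 + r⁻¹`.
      obtain ⟨P, hP⟩ := Hyperbolic.exists_conj_eq_mul (A := A) (s := r) (by exact_mod_cast hr0)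
        (by exact_mod_cast hr.ne') (by
          rw [htr, hdet, ← hrσ]
          norm_cast
          field_simp
          ring)
      exact ⟨P, r, by linarith, hr.ne', fun w => by rw [hf.1, hP]⟩
    · have hσ2 : σ = -2 := by
        rw [hc] at h
        have : σ + 2 = 0 := by exact_mod_cast h
        linarith
      subst hσ2
      refine ⟨⟨T, hact, Hyperbolic.ellipticType_one_of_charpoly hchar hσ (by norm_num)
        (hfix (by norm_num))⟩, ?_⟩
      obtain ⟨P, hP⟩ := Hyperbolic.exists_conj_eq_mul (A := A) (s := -1) (by norm_num)
        (by norm_num) (by rw [htr]; simp)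
      exact ⟨P, fun w => by rw [hf.1, hP]; simp only [neg_one_mul]⟩
    · have hσ2 : σ = 2 := by
        rcases eq_or_eq_neg_of_abs_eq h with h | h
        · exact h
        · exact absurd (by rw [hc, h]; simp) h0
      subst hσ2
      refine ⟨⟨T, hact, Hyperbolic.parabolicType_zero_of_charpoly hchar fun h => hns (hone h)⟩, ?_⟩
      obtain ⟨P, β, hβ, hP⟩ := Hyperbolic.exists_conj_eq_add (A := A)
        (fun μ hμ => hns (Hyperbolic.isRealScalar_of_mem_lifts hA hμ)) (by
          rw [htr, hdet]
          push_cast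
          ring)
      exact ⟨P, β, hβ, fun w => by rw [hf.1, hP]⟩
    · obtain ⟨r, hr⟩ := h
      funext w
      rw [hf.1, Hyperbolic.smul_scalar hr, id]
  · subst hB
    obtain ⟨T, σ, δ, hact, hσ, hδ, hdet, htr, hchar, hfix⟩ :=
      Hyperbolic.exists_lorentz_of_reversing hA hf
    have hδ' : (δ : ℂ) ≠ 0 := by exact_mod_cast hδ.ne'
    have hc : Hyperbolic.cInv (A * Hyperbolic.conjMatrix A) - 2 = ((σ ^ 2 - 2 : ℝ) : ℂ) := by
      rw [Hyperbolic.cInv, hdet, htr]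
      push_cast
      field_simp
    have hnorm : ‖Hyperbolic.cInv (A * Hyperbolic.conjMatrix A) - 2‖ = σ ^ 2 - 2 := by
      rw [hc, Complex.norm_real, Real.norm_of_nonneg (by nlinarith)]
    rw [hnorm]
    refine ⟨fun h => ⟨T, hact, ?_⟩, fun _ h => ?_, fun h => ?_⟩
    · exact Hyperbolic.hyperbolicType_zero_odd_of_charpoly hchar (by nlinarith)
    -- Vacuous: `σ ≥ 2` gives `σ² - 2 ≥ 2`.
    · nlinarith
    · obtain ⟨r, hr⟩ := h
      have hd : r ^ 2 = δ ^ 2 := by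
        rw [hr] at hdet
        simp only [det_smul, det_one, Fintype.card_fin, mul_one] at hdet
        exact_mod_cast hdet
      have ht : 2 * r = δ * σ := by
        rw [hr] at htr
        simp only [trace_smul, trace_one, Fintype.card_fin, smul_eq_mul] at htr
        rw [mul_comm]
        exact_mod_cast htr
      -- From `2r = δσ > 0` and `r² = δ²` follow `r = δ` and `σ = 2`.
      have hr0 : 0 < r := by nlinarith
      have hrδ : r = δ := (pow_left_inj₀ hr0.le hδ.le two_ne_zero).1 hd
      subst hrδ
      have hσ2 : σ = 2 := mul_left_cancel₀ hr0.ne' (by linarith)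
      subst hσ2
      exact ⟨⟨T, hact, Hyperbolic.ellipticType_zero_odd_of_charpoly hchar (hfix rfl)⟩,
        Hyperbolic.isCircleInversion_of_mul_conj hr0 hr hf.1⟩
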